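/- Let $K$ be a (not necessarily commutative) field, $E$ a left vector space over $K$, $F$ a right vector space over $K$, and $\langle\cdot,\cdot\rangle$ a nondegenerate bilinear form on $E\times F$ (so that $(E,F)$ is a pair of dual spaces). Equip $E$ with the linear weak topology $\sigma(E,F)$, for which the subspaces $G^{\perp}=\{x\in E \mid \langle x,y\rangle=0 \text{ for all } y\in G\}$, with $G$ a finite-dimensional subspace of $F$, form a basis of neighbourhoods of $0$, and let $\mathcal{B}(E)$ be the ring of all continuous linear mappings $E\to E$. The set $\mathrm{Proj}(E)$ of continuous linear projections (idempotents of $\mathcal{B}(E)$) is an orthoposet, with $p\le q$ if and only if $\mathrm{Im}\,p\subseteq\mathrm{Im}\,q$ and $\mathrm{Ker}\,q\subseteq\mathrm{Ker}\,p$, and with $p^{\perp}=1-p$. An automorphism of this orthoposet is a bijection which, together with its inverse, preserves the order, and which commutes with $\perp$. It is called even if it maps projections with the same image to projections with the same image, and odd if it maps projections with the same image to projections with the same kernel. 1. The restriction to $\mathrm{Proj}(E)$ of every automorphism of the ring $\mathcal{B}(E)$ is an even automorphism of the orthoposet $\mathrm{Proj}(E)$, and the restriction to $\mathrm{Proj}(E)$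 of every anti-automorphism of the ring $\mathcal{B}(E)$ is an odd automorphism of the orthoposet $\mathrm{Proj}(E)$. 2. Conversely, if $\dim E\neq 2$, every even automorphism of the orthoposet $\mathrm{Proj}(E)$ extends to an automorphism of the ring $\mathcal{B}(E)$ of the form $T\mapsto STS^{-1}$, where $S:E\to E$ is a bicontinuous semi-linear bijection (with respect to some automorphism of $K$). -/

import Mathlib

/-- A bilinear form `B` on `E × F`, where `E` is a left and `F` a right vector space over a
(not necessarily commutative) field `K`, makes `(E, F)` a pair of dual spaces if it is
nondegenerate on both sides. Right vector spaces are modules over `Kᵐᵒᵖ`, so that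
`B (a • x) (y • b) = a * B x y * b`. -/
structure IsDualPair {K E F : Type*} [DivisionRing K] [AddCommGroup E] [Module K E]
    [AddCommGroup F] [Module Kᵐᵒᵖ F] (B : E →ₗ[K] F →ₗ[Kᵐᵒᵖ] K) : Prop where
  left : ∀ x : E, (∀ y : F, B x y = 0) → x = 0
  right : ∀ y : F, (∀ x : E, B x y = 0) → y = 0

/-- The space `E`, to be equipped with the linear weak topology `σ(E, F)`. -/
def LinWeak {K E F : Type*} [DivisionRing K] [AddCommGroup E] [Module K E]
    [AddCommGroup F] [Module Kᵐᵒᵖ F] (_B : E →ₗ[K] F →ₗ[Kᵐᵒᵖ] K) : Type _ := E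

namespace LinWeak

variable {K E F : Type*} [DivisionRing K] [AddCommGroup E] [Module K E]
  [AddCommGroup F] [Module Kᵐᵒᵖ F] (B : E →ₗ[K] F →ₗ[Kᵐᵒᵖ] K)

instance : AddCommGroup (LinWeak B) := inferInstanceAs (AddCommGroup E)

instance : Module K (LinWeak B) := inferInstanceAs (Module K E)

/-- The form, as a form on `LinWeak B`. -/
def form : LinWeak B →ₗ[K] F →ₗ[Kᵐᵒᵖ] K := B

/-- The subspace `G^⊥ = {x ∈ E | B(x, y) = 0 for all y ∈ G}` of `E`. -/
def perp (G : Submodule Kᵐᵒᵖ F) : Submodule K (LinWeak B) where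
  carrier := {x | ∀ y ∈ G, form B x y = 0}
  add_mem' := by
    intro a b ha hb y hy
    simp [ha y hy, hb y hy]
  zero_mem' := by
    intro y _
    simp
  smul_mem' := by
    intro c x hx y hy
    simp [hx y hy]

theorem perp_anti {G H : Submodule Kᵐᵒᵖ F} (h : G ≤ H) : perp B H ≤ perp B G :=
  fun _ hx y hy => hx y (h hy)

/-- The linear weak topology `σ(E, F)`: the translation-invariant topology for which the
subspaces `G^⊥`, with `G` a finite-dimensional subspace of `F`, form a basis of
neighbourhoods of `0`. -/
instance : TopologicalSpace (LinWeak B) where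
  IsOpen U := ∀ x ∈ U, ∃ G : Submodule Kᵐᵒᵖ F, FiniteDimensional Kᵐᵒᵖ G ∧
    ∀ z ∈ perp B G, x + z ∈ U
  isOpen_univ := fun _ _ => ⟨⊥, inferInstance, fun _ _ => trivial⟩
  isOpen_inter := by
    intro U V hU hV x hx
    obtain ⟨G, hG, h1⟩ := hU x hx.1
    obtain ⟨H, hH, h2⟩ := hV x hx.2
    exact ⟨G ⊔ H, inferInstance, fun z hz =>
      ⟨h1 z (perp_anti B le_sup_left hz), h2 z (perp_anti B le_sup_right hz)⟩⟩
  isOpen_sUnion := by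
    intro S hS x hx
    obtain ⟨U, hU, hxU⟩ := hx
    obtain ⟨G, hG, h⟩ := hS U hU x hxU
    exact ⟨G, hG, fun z hz => ⟨U, hU, h z hz⟩⟩

theorem isOpen_iff {U : Set (LinWeak B)} : IsOpen U ↔ ∀ x ∈ U, ∃ G : Submodule Kᵐᵒᵖ F,
    FiniteDimensional Kᵐᵒᵖ G ∧ ∀ z ∈ perp B G, x + z ∈ U := Iff.rfl

theorem mem_nhds_iff' {x : LinWeak B} {U : Set (LinWeak B)} : U ∈ nhds x ↔
    ∃ G : Submodule Kᵐᵒᵖ F, FiniteDimensional Kᵐᵒᵖ G ∧ ∀ z ∈ perp B G, x + z ∈ U := by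
  rw [_root_.mem_nhds_iff]
  constructor
  · rintro ⟨V, hVU, hV, hx⟩
    obtain ⟨G, hG, h⟩ := hV x hx
    exact ⟨G, hG, fun z hz => hVU (h z hz)⟩
  · rintro ⟨G, hG, h⟩
    refine ⟨{w | ∃ z ∈ perp B G, w = x + z}, ?_, ?_, 0, zero_mem _, by simp⟩
    · rintro w ⟨z, hz, rfl⟩
      exact h z hz
    · rintro w ⟨z, hz, rfl⟩
      exact ⟨G, hG, fun z' hz' => ⟨z + z', add_mem hz hz', add_assoc _ _ _⟩⟩

instance : IsTopologicalAddGroup (LinWeak B) where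
  continuous_add := by
    rw [continuous_iff_continuousAt]
    rintro ⟨x, y⟩ U hU
    obtain ⟨G, hG, h⟩ := (mem_nhds_iff' B).1 hU
    have key : ∀ a : LinWeak B, {w | ∃ z ∈ perp B G, w = a + z} ∈ nhds a := fun a =>
      (mem_nhds_iff' B).2 ⟨G, hG, fun z hz => ⟨z, hz, rfl⟩⟩
    rw [nhds_prod_eq, Filter.mem_map]
    refine Filter.mem_of_superset (Filter.prod_mem_prod (key x) (key y)) ?_
    rintro ⟨_, _⟩ ⟨⟨z, hz, rfl⟩, ⟨z', hz', rfl⟩⟩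
    have := h (z + z') (add_mem hz hz')
    simpa [add_add_add_comm] using this
  continuous_neg := by
    rw [continuous_iff_continuousAt]
    intro x U hU
    obtain ⟨G, hG, h⟩ := (mem_nhds_iff' B).1 hU
    refine (mem_nhds_iff' B).2 ⟨G, hG, fun z hz => ?_⟩
    have := h (-z) (neg_mem hz)
    simpa [add_comm] using this

end LinWeak

/-- The ring `𝓑(E)` of all `σ(E, F)`-continuous linear mappings `E → E`. -/
abbrev ContEnd {K E F : Type*} [DivisionRing K] [AddCommGroup E] [Module K E]
    [AddCommGroup F] [Module Kᵐᵒᵖ F] (B : E →ₗ[K] F →ₗ[Kᵐᵒᵖ] K) : Type _ :=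
  LinWeak B →L[K] LinWeak B

/-- The continuous linear projections of `E`, i.e. the idempotents of the ring `𝓑(E)`. -/
@[ext]
structure ContProj {K E F : Type*} [DivisionRing K] [AddCommGroup E] [Module K E]
    [AddCommGroup F] [Module Kᵐᵒᵖ F] (B : E →ₗ[K] F →ₗ[Kᵐᵒᵖ] K) where
  toEnd : ContEnd B
  idem : toEnd * toEnd = toEnd

namespace ContProj

variable {K E F : Type*} [DivisionRing K] [AddCommGroup E] [Module K E]
  [AddCommGroup F] [Module Kᵐᵒᵖ F] {B : E →ₗ[K] F →ₗ[Kᵐᵒᵖ] K}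

/-- The image of a projection. -/
def im (p : ContProj B) : Submodule K (LinWeak B) := LinearMap.range p.toEnd.toLinearMap

/-- The kernel of a projection. -/
def ker (p : ContProj B) : Submodule K (LinWeak B) := LinearMap.ker p.toEnd.toLinearMap

theorem apply_apply (p : ContProj B) (x : LinWeak B) :
    p.toEnd (p.toEnd x) = p.toEnd x := congrArg (fun T : ContEnd B => T x) p.idem

theorem apply_of_mem_im (p : ContProj B) {x : LinWeak B} (hx : x ∈ p.im) : p.toEnd x = x := by
  obtain ⟨y, rfl⟩ := hx
  exact p.apply_apply y

/-- `p ≤ q` means `Im p ⊆ Im q` and `Ker q ⊆ Ker p`. -/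
instance : PartialOrder (ContProj B) where
  le p q := p.im ≤ q.im ∧ q.ker ≤ p.ker
  le_refl _ := ⟨le_rfl, le_rfl⟩
  le_trans _ _ _ h h' := ⟨h.1.trans h'.1, h'.2.trans h.2⟩
  le_antisymm p q h h' := by
    ext x
    have h1 : p.toEnd x ∈ q.im := h.1 ⟨x, rfl⟩
    have h2 : x - p.toEnd x ∈ p.ker := by
      change p.toEnd (x - p.toEnd x) = 0
      rw [map_sub, p.apply_apply, sub_self]
    have h3 : q.toEnd (x - p.toEnd x) = 0 := h'.2 h2
    rw [map_sub, q.apply_of_mem_im h1, sub_eq_zero] at h3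
    exact h3.symm

/-- The orthocomplement `p^⊥ = 1 - p`, with image `Ker p` and kernel `Im p`. -/
instance : Compl (ContProj B) where
  compl p := ⟨1 - p.toEnd, by
    rw [mul_sub, sub_mul, sub_mul, p.idem]
    simp⟩

/-- An automorphism of the poset of continuous projections is an automorphism of the orthoposet
if it commutes with the orthocomplementation. -/
def IsOrthoAut (φ : ContProj B ≃o ContProj B) : Prop := ∀ p : ContProj B, φ pᶜ = (φ p)ᶜ

/-- Even: projections with the same image go to projections with the same image. -/
def IsEven (φ : ContProj B ≃o ContProj B) : Prop :=
  ∀ p q : ContProj B, p.im = q.im → (φ p).im = (φ q).im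

/-- Odd: projections with the same image go to projections with the same kernel. -/
def IsOdd (φ : ContProj B ≃o ContProj B) : Prop :=
  ∀ p q : ContProj B, p.im = q.im → (φ p).ker = (φ q).ker

end ContProj

/-!
The first two assertions are algebraic: for idempotents, `Im p ⊆ Im q` means `qp = p` and
`Ker q ⊆ Ker p` means `pq = p`. Both relations are preserved by ring automorphisms and exchanged by
anti-automorphisms.

For the converse, in dimension at least three, the points of the projective space of `E` are the
images of the atoms of `Proj(E)`, the projections of rank one. An even automorphism `φ` that
commutes with `⊥` preserves equality of images and equality of kernels, and on atoms so does its
inverse (`ContProj.RespectsAtoms.symm`). It therefore induces a bijection of the points,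
represented by a map `f` on vectors, and `p x = 0` if and only if `(φ p) (f x) = 0` for every atom `p`
(`ContProj.IsPointMap.apply_eq_zero_iff`). As a plane is the intersection of the kernels of the
atoms vanishing on it, `f` preserves collinearity in both directions, and the fundamental theorem of
projective geometry (`exists_semilinearEquiv_span_eq`) provides a semilinear bijection `S` that
induces the same map on points. It is bicontinuous because the kernels of the atoms are the
hyperplanes that generate the topology, and `S` permutes them. Finally `S` maps `Im p` into
`Im (φ p)` and `Ker p`, the image of `p^⊥`, into `Ker (φ p)`, whence `φ p = S p S⁻¹`.

In dimension at most one there are no projections besides `0` and `1`, and `S` is the identity.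
-/

section

open Submodule

/-! ### The fundamental theorem of projective geometry over division rings -/

section FundamentalTheorem

variable {K L V W : Type*} [DivisionRing K] [DivisionRing L] [AddCommGroup V] [Module K V]
  [AddCommGroup W] [Module L W]

theorem eq_zero_of_smul_add_smul_eq_zero {x y : V} (hx : x ≠ 0) (hy : y ∉ span K {x})
    {α β : K} (h : α • x + β • y = 0) : α = 0 ∧ β = 0 := by
  have hβ : β = 0 := by
    by_contra hβ
    refine hy (mem_span_singleton.2 ⟨-(β⁻¹ * α), ?_⟩)
    have h2 : β • y = -(α • x) := (neg_eq_of_add_eq_zero_right h).symm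
    rw [neg_smul, mul_smul, ← smul_neg, ← h2, inv_smul_smul₀ hβ]
  subst hβ
  simpa [hx] using h

theorem eq_zero_of_smul_add_smul_add_smul_eq_zero {x y z : V} (hx : x ≠ 0)
    (hy : y ∉ span K {x}) (hz : z ∉ span K {x, y}) {α β γ : K}
    (h : α • x + β • y + γ • z = 0) : α = 0 ∧ β = 0 ∧ γ = 0 := by
  have hγ : γ = 0 := by
    by_contra hγ
    refine hz (mem_span_pair.2 ⟨-(γ⁻¹ * α), -(γ⁻¹ * β), ?_⟩)
    have h2 : γ • z = -(α • x + β • y) := (neg_eq_of_add_eq_zero_right h).symm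
    rw [← inv_smul_smul₀ hγ z, h2]
    simp only [neg_smul, mul_smul, smul_neg, smul_add]
    abel
  subst hγ
  obtain ⟨h1, h2⟩ := eq_zero_of_smul_add_smul_eq_zero hx hy (by simpa using h)
  exact ⟨h1, h2, rfl⟩

/-- An additive injection that preserves and reflects membership in spans of pairs, and meets every
line of `W`, is bijective and semilinear, in dimension at least three. The scalar by which `S` maps
`a • x` is determined at one vector `x₀`; additivity on `x₀ + y` carries it to every other `y`. -/
theorem exists_semilinear_of_mem_span_pair_iff (S : V →+ W)
    (hinj : ∀ x, S x = 0 → x = 0)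
    (hcol : ∀ x a b, x ∈ span K {a, b} ↔ S x ∈ span L {S a, S b})
    (hsurj : ∀ w, ∃ v, w ∈ span L {S v})
    (hdim : ∀ a b : V, ∃ c, c ∉ span K {a, b}) :
    Function.Bijective S ∧ ∃ σ : K ≃+* L, ∀ a x, S (a • x) = σ a • S x := by
  have hcol1 : ∀ x a, x ∈ span K {a} ↔ S x ∈ span L {S a} := fun x a => by
    simpa using hcol x a a
  have hdim1 : ∀ a : V, ∃ c, c ∉ span K {a} := fun a => by simpa using hdim a a
  obtain ⟨x₀, hx₀⟩ := hdim1 0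
  have hx0 : x₀ ≠ 0 := by rintro rfl; exact hx₀ (zero_mem _)
  have hS0 : S x₀ ≠ 0 := fun h => hx0 (hinj _ h)
  have hmul : ∀ (a : K) (x : V), ∃ m : L, S (a • x) = m • S x := fun a x => by
    have := (hcol1 (a • x) x).1 (smul_mem _ _ (mem_span_singleton_self x))
    obtain ⟨m, hm⟩ := mem_span_singleton.1 this
    exact ⟨m, hm.symm⟩
  choose σ hσ using fun a => hmul a x₀
  have hout : ∀ (a : K) (y : V), y ∉ span K {x₀} → S (a • y) = σ a • S y := by
    intro a y hy
    obtain ⟨m, hm⟩ := hmul a y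
    obtain ⟨n, hn⟩ := hmul a (x₀ + y)
    rw [smul_add, map_add, map_add, hσ, hm, smul_add] at hn
    have hy' : S y ∉ span L {S x₀} := fun h => hy ((hcol1 _ _).2 h)
    obtain ⟨h1, h2⟩ := eq_zero_of_smul_add_smul_eq_zero hS0 hy' (α := σ a - n) (β := m - n) (by
      rw [sub_smul, sub_smul, sub_add_sub_comm, hn, sub_self])
    rw [hm, sub_eq_zero.1 h1, sub_eq_zero.1 h2]
  -- a multiple `y` of `x₀` is the difference of the two vectors `y + z` and `z` off the line
  have hall : ∀ (a : K) (y : V), S (a • y) = σ a • S y := by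
    intro a y
    by_cases hy : y ∈ span K {x₀}
    · obtain ⟨z, hz⟩ := hdim1 x₀
      have h1 := hout a z hz
      have h2 := hout a (y + z) fun h => hz ((add_mem_cancel_left hy).1 h)
      rw [smul_add, map_add, map_add, h1, smul_add] at h2
      exact add_right_cancel h2
    · exact hout a y hy
  have hcancel : ∀ {a b : L}, a • S x₀ = b • S x₀ → a = b := fun h =>
    smul_left_injective L hS0 h
  let σ' : K →+* L :=
    { toFun := σ
      map_one' := hcancel (by rw [← hall, one_smul, one_smul])
      map_mul' := fun a b => hcancel (by rw [← hall, mul_smul, hall, hall, mul_smul])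
      map_zero' := hcancel (by rw [← hall, zero_smul, zero_smul, map_zero])
      map_add' := fun a b => hcancel (by rw [← hall, add_smul, map_add, hall, hall, add_smul]) }
  -- `m` is recovered from a vector mapped onto the line of `S x₀ + m • S y`
  have hσs : Function.Surjective σ' := by
    intro m
    obtain ⟨y, hy⟩ := hdim1 x₀
    have hy' : S y ∉ span L {S x₀} := fun h => hy ((hcol1 _ _).2 h)
    obtain ⟨v, hv⟩ := hsurj (S x₀ + m • S y)
    obtain ⟨c, hc⟩ := mem_span_singleton.1 hv
    have hc0 : c ≠ 0 := by
      rintro rfl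
      have := eq_zero_of_smul_add_smul_eq_zero hS0 hy' (α := 1) (β := m) (by
        rw [one_smul, ← hc, zero_smul])
      exact one_ne_zero this.1
    have hv' : S v ∈ span L {S x₀, S y} := by
      rw [← inv_smul_smul₀ hc0 (S v), hc]
      exact smul_mem _ _ (mem_span_pair.2 ⟨1, m, by rw [one_smul]⟩)
    obtain ⟨α, β, rfl⟩ := mem_span_pair.1 ((hcol _ _ _).2 hv')
    rw [map_add, hall, hall, smul_add, smul_smul, smul_smul] at hc
    obtain ⟨h1, h2⟩ := eq_zero_of_smul_add_smul_eq_zero hS0 hy'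
      (α := c * σ α - 1) (β := c * σ β - m) (by
        rw [sub_smul, sub_smul, sub_add_sub_comm, hc, one_smul, sub_self])
    have h3 : (σ α)⁻¹ = c := inv_eq_of_mul_eq_one_left (sub_eq_zero.1 h1)
    refine ⟨α⁻¹ * β, ?_⟩
    rw [map_mul, map_inv₀]
    change (σ α)⁻¹ * σ β = m
    rw [h3, sub_eq_zero.1 h2]
  refine ⟨⟨(injective_iff_map_eq_zero S).2 hinj, fun w => ?_⟩,
    RingEquiv.ofBijective σ' ⟨σ'.injective, hσs⟩, hall⟩
  obtain ⟨v, hv⟩ := hsurj w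
  obtain ⟨c, hc⟩ := mem_span_singleton.1 hv
  obtain ⟨a, rfl⟩ := hσs c
  exact ⟨a • v, (hall a v).trans hc⟩

/-- A map `f` that preserves collinearity can be rescaled to be additive off a line: `T x` is the
multiple of `f x` for which `f a + T x` lies on the line of `f (a + x)`. -/
theorem exists_additive_off_line (f : V → W) (h0 : ∀ x, f x = 0 → x = 0)
    (hcol : ∀ x a b, x ∈ span K {a, b} ↔ f x ∈ span L {f a, f b})
    (hdim : ∀ a b : V, ∃ c, c ∉ span K {a, b}) {a : V} (ha : a ≠ 0) :
    ∃ T : V → W, (∀ x ∉ span K {a}, T x ∈ span L {f x} ∧ T x ≠ 0) ∧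
      ∀ x y, x ∉ span K {a} → y ∉ span K {a} → x + y ∉ span K {a} → T (x + y) = T x + T y := by
  have hcol1 : ∀ x a, x ∈ span K {a} ↔ f x ∈ span L {f a} := fun x a => by
    simpa using hcol x a a
  have hA : f a ≠ 0 := fun h => ha (h0 _ h)
  have hex : ∀ x, ∃ t, x ∉ span K {a} →
      (t ∈ span L {f x} ∧ t ≠ 0) ∧ f a + t ∈ span L {f (a + x)} := by
    intro x
    by_cases hx : x ∈ span K {a}
    · exact ⟨0, fun h => (h hx).elim⟩
    have hmem : f (a + x) ∈ span L {f a, f x} :=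
      (hcol _ _ _).1 (mem_span_pair.2 ⟨1, 1, by simp⟩)
    obtain ⟨α, β, hαβ⟩ := mem_span_pair.1 hmem
    have hα : α ≠ 0 := by
      rintro rfl
      have h1 : a + x ∈ span K {x} := (hcol1 _ _).2 (mem_span_singleton.2 ⟨β, by simpa using hαβ⟩)
      obtain ⟨c, hc⟩ := mem_span_singleton.1
        ((add_mem_cancel_right (mem_span_singleton_self x)).1 h1)
      have := eq_zero_of_smul_add_smul_eq_zero ha hx (α := 1) (β := -c) (by
        rw [neg_smul, hc, one_smul, add_neg_cancel])
      exact one_ne_zero this.1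
    have hβ : β ≠ 0 := by
      rintro rfl
      have h1 : a + x ∈ span K {a} := (hcol1 _ _).2 (mem_span_singleton.2 ⟨α, by simpa using hαβ⟩)
      exact hx ((add_mem_cancel_left (mem_span_singleton_self a)).1 h1)
    have hX : f x ≠ 0 := fun h => hx (by rw [h0 x h]; exact zero_mem _)
    refine ⟨α⁻¹ • β • f x, fun _ => ⟨⟨smul_mem _ _ (smul_mem _ _ (mem_span_singleton_self _)),
      smul_ne_zero (inv_ne_zero hα) (smul_ne_zero hβ hX)⟩, mem_span_singleton.2 ⟨α⁻¹, ?_⟩⟩⟩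
    rw [← hαβ, smul_add, inv_smul_smul₀ hα]
  choose T hT using hex
  -- `f (a + (x + y))` lies in the plane of `f (a + x)` and `f y`, so that the coefficients of
  -- `f a + T (x + y)` and `f a + T x` at `f x` agree
  have half : ∀ x y, x ∉ span K {a} → y ∉ span K {a, x} →
      ∃ q : L, T (x + y) = T x + q • f y := by
    intro x y hx hy
    have hxy : x + y ∉ span K {a} := fun h => hy (by
      have h1 : x ∈ span K {a, x} := subset_span (by simp)
      exact (add_mem_cancel_left h1).1 (span_mono (by simp) h))
    obtain ⟨⟨hT1, -⟩, hT2⟩ := hT (x + y) hxy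
    obtain ⟨⟨hx1, -⟩, hx2⟩ := hT x hx
    obtain ⟨c, hc⟩ := mem_span_singleton.1 hT1
    obtain ⟨p, q, hpq⟩ := mem_span_pair.1
      ((hcol (x + y) x y).1 (mem_span_pair.2 ⟨1, 1, by simp⟩))
    obtain ⟨ξ, hξ⟩ := mem_span_singleton.1 hx1
    obtain ⟨s, hs⟩ := mem_span_singleton.1 hT2
    obtain ⟨m, hm⟩ := mem_span_singleton.1 hx2
    obtain ⟨u, v, huv⟩ := mem_span_pair.1
      ((hcol (a + (x + y)) (a + x) y).1 (mem_span_pair.2 ⟨1, 1, by simp [add_assoc]⟩))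
    have hX : f x ∉ span L {f a} := fun h => hx ((hcol1 _ _).2 h)
    have hY : f y ∉ span L {f a, f x} := fun h => hy ((hcol _ _ _).2 h)
    have hm0 : m ≠ 0 := by
      rintro rfl
      have := eq_zero_of_smul_add_smul_eq_zero hA hX (α := 1) (β := ξ) (by
        rw [one_smul, hξ, ← hm, zero_smul])
      exact one_ne_zero this.1
    have hfx : f (a + x) = m⁻¹ • (f a + ξ • f x) := by
      rw [hξ, ← hm, inv_smul_smul₀ hm0]
    rw [← hc, ← hpq, ← huv, hfx] at hs
    obtain ⟨h1, h2, h3⟩ := eq_zero_of_smul_add_smul_add_smul_eq_zero hA hX hY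
      (α := s * u * m⁻¹ - 1) (β := s * u * m⁻¹ * ξ - c * p) (γ := s * v - c * q) (by
        rw [← sub_eq_zero] at hs
        rw [← hs]
        simp only [sub_smul, mul_smul, smul_add, one_smul]
        abel)
    refine ⟨c * q, ?_⟩
    rw [sub_eq_zero.1 h1, one_mul, sub_eq_zero] at h2
    rw [← hc, ← hpq, ← hξ, h2, smul_add, mul_smul, mul_smul]
  have indep : ∀ x y, x ∉ span K {a} → y ∉ span K {a, x} → T (x + y) = T x + T y := by
    intro x y hx hy
    have hy1 : y ∉ span K {a} := fun h => hy (span_mono (by simp) h)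
    have hx1 : x ∉ span K {a, y} := by
      intro h
      obtain ⟨α, β, rfl⟩ := mem_span_pair.1 h
      have hβ : β ≠ 0 := by
        rintro rfl
        exact hx (mem_span_singleton.2 ⟨α, by simp⟩)
      refine hy (mem_span_pair.2 ⟨-(β⁻¹ * α), β⁻¹, ?_⟩)
      rw [smul_add, inv_smul_smul₀ hβ, neg_smul, mul_smul]
      abel
    have hX : f x ∉ span L {f a} := fun h => hx ((hcol1 _ _).2 h)
    have hY : f y ∉ span L {f a, f x} := fun h => hy ((hcol _ _ _).2 h)
    obtain ⟨q, hq⟩ := half x y hx hy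
    obtain ⟨p, hp⟩ := half y x hy1 hx1
    obtain ⟨ξ, hξ⟩ := mem_span_singleton.1 (hT x hx).1.1
    obtain ⟨η, hη⟩ := mem_span_singleton.1 (hT y hy1).1.1
    rw [add_comm y x, hq, ← hξ, ← hη, ← sub_eq_zero] at hp
    obtain ⟨-, -, h3⟩ := eq_zero_of_smul_add_smul_add_smul_eq_zero hA hX hY
      (α := 0) (β := ξ - p) (γ := q - η) (by
        rw [← hp]
        simp only [sub_smul, zero_smul]
        abel)
    rw [hq, sub_eq_zero.1 h3, hη]
  refine ⟨T, fun x hx => (hT x hx).1, fun x y hx hy hxy => ?_⟩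
  -- if `y` is in the plane of `a` and `x`, add a vector `z` outside that plane
  by_cases hyx : y ∈ span K {a, x}
  · obtain ⟨z, hz⟩ := hdim a x
    have ha' : a ∈ span K {a, x} := subset_span (by simp)
    have hx' : x ∈ span K {a, x} := subset_span (by simp)
    have h1 := indep (x + y) z hxy fun h => hz (span_le.2 (by
      rintro _ (rfl | rfl); exacts [ha', add_mem hx' hyx]) h)
    have h2 := indep y z hy fun h => hz (span_le.2 (by
      rintro _ (rfl | rfl); exacts [ha', hyx]) h)
    have h3 := indep x (y + z) hx fun h => hz ((add_mem_cancel_left hyx).1 h)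
    rw [add_assoc, h3, h2, ← add_assoc] at h1
    exact (add_right_cancel h1).symm
  · exact indep x y hx hyx

/-- A map that is additive off the line of `a` extends to an additive map: on that line, the
extension is `x ↦ T (x + b) - T b`, which is independent of the choice of `b` off the line. -/
theorem exists_additive_extension {T : V → W} {a : V}
    (hdim : ∀ a b : V, ∃ c, c ∉ span K {a, b})
    (hT : ∀ x y, x ∉ span K {a} → y ∉ span K {a} → x + y ∉ span K {a} → T (x + y) = T x + T y) :
    ∃ S : V →+ W, ∀ x ∉ span K {a}, S x = T x := by
  classical
  obtain ⟨b₀, hb₀⟩ := hdim a a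
  rw [Set.pair_eq_singleton] at hb₀
  have key : ∀ x ∈ span K {a}, ∀ b ∉ span K {a}, ∀ c ∉ span K {a}, b + c ∉ span K {a} →
      T (x + b) - T b = T (x + c) - T c := by
    intro x hx b hb c hc hbc
    have hxb : x + b ∉ span K {a} := fun h => hb ((add_mem_cancel_left hx).1 h)
    have hxc : x + c ∉ span K {a} := fun h => hc ((add_mem_cancel_left hx).1 h)
    have hxbc : x + b + c ∉ span K {a} := fun h => hbc (by
      rw [add_assoc] at h; exact (add_mem_cancel_left hx).1 h)
    have h1 := hT (x + b) c hxb hc hxbc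
    have h2 := hT (x + c) b hxc hb (by rwa [add_right_comm])
    rw [add_right_comm, h1] at h2
    rw [sub_eq_sub_iff_add_eq_add, h2]
  have key' : ∀ x ∈ span K {a}, ∀ b ∉ span K {a}, ∀ c ∉ span K {a},
      T (x + b) - T b = T (x + c) - T c := by
    intro x hx b hb c hc
    by_cases hbc : b + c ∈ span K {a}
    · obtain ⟨d, hd⟩ := hdim a b
      have hle : span K {a} ≤ span K {a, b} := span_mono (by simp)
      have hb' : b ∈ span K {a, b} := subset_span (by simp)
      have hc' : c ∈ span K {a, b} := (add_mem_cancel_left hb').1 (hle hbc)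
      have hda : d ∉ span K {a} := fun h => hd (hle h)
      rw [key x hx b hb d hda fun h => hd ((add_mem_cancel_left hb').1 (hle h)),
        key x hx c hc d hda fun h => hd ((add_mem_cancel_left hc').1 (hle h))]
    · exact key x hx b hb c hc hbc
  let S : V → W := fun x => if x ∈ span K {a} then T (x + b₀) - T b₀ else T x
  have hS : ∀ x b, b ∉ span K {a} → x + b ∉ span K {a} → T (x + b) = S x + T b := by
    intro x b hb hxb
    by_cases hx : x ∈ span K {a}
    · simp only [S, if_pos hx, key' x hx b₀ hb₀ b hb, sub_add_cancel]
    · simp only [S, if_neg hx, hT x b hx hb hxb]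
  have hSout : ∀ x ∉ span K {a}, S x = T x := fun x hx => if_neg hx
  refine ⟨AddMonoidHom.mk' S fun x y => ?_, hSout⟩
  have hle : ∀ z, span K {a} ≤ span K {a, z} := fun z => span_mono (by simp)
  by_cases hx : x ∈ span K {a, y}
  · obtain ⟨b, hb⟩ := hdim a y
    have hy' : y ∈ span K {a, y} := subset_span (by simp)
    have h1 : b ∉ span K {a} := fun h => hb (hle y h)
    have h2 : y + b ∉ span K {a} := fun h => hb ((add_mem_cancel_left hy').1 (hle y h))
    have h3 : x + y + b ∉ span K {a} := fun h =>
      hb ((add_mem_cancel_left (add_mem hx hy')).1 (hle y h))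
    have e1 := hS (x + y) b h1 h3
    rw [add_assoc, hS x (y + b) h2 (by rwa [← add_assoc]), hS y b h1 h2, ← add_assoc] at e1
    exact (add_right_cancel e1).symm
  · have hxa : x ∉ span K {a} := fun h => hx (hle y h)
    have hxy : x + y ∉ span K {a} := fun h => hx
      ((add_mem_cancel_right (subset_span (by simp))).1 (hle y h))
    rw [hSout _ hxy, add_comm x y, hS y x hxa (by rwa [add_comm]), hSout x hxa, add_comm]

/-- The fundamental theorem of projective geometry, in vector form: in dimension at least three, a
map that preserves and reflects collinearity, and is onto up to scalars, agrees up to scalars with a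
semilinear bijection. -/
theorem exists_semilinearEquiv_span_eq (f : V → W) (h0 : ∀ x, f x = 0 ↔ x = 0)
    (hcol : ∀ x a b, x ∈ span K {a, b} ↔ f x ∈ span L {f a, f b})
    (hsurj : ∀ w, ∃ v, w ∈ span L {f v})
    (hdim : ∀ a b : V, ∃ c, c ∉ span K {a, b}) :
    ∃ (S : V ≃+ W) (σ : K ≃+* L), (∀ a x, S (a • x) = σ a • S x) ∧
      ∀ x, span L {S x} = span L {f x} := by
  have hcol1 : ∀ x a, x ∈ span K {a} ↔ f x ∈ span L {f a} := fun x a => by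
    simpa using hcol x a a
  obtain ⟨a, ha⟩ := hdim 0 0
  have ha0 : a ≠ 0 := by rintro rfl; exact ha (zero_mem _)
  obtain ⟨T, hT1, hT2⟩ := exists_additive_off_line f (fun x => (h0 x).1) hcol hdim ha0
  obtain ⟨S, hS⟩ := exists_additive_extension hdim hT2
  have hmem : ∀ x, S x ∈ span L {f x} := by
    intro x
    by_cases hx : x ∈ span K {a}
    · by_cases hx0 : x = 0
      · rw [hx0, map_zero]; exact zero_mem _
      have key : ∀ b ∉ span K {a}, S x ∈ span L {f x, f b} := by
        intro b hb
        have hxb : x + b ∉ span K {a} := fun h => hb ((add_mem_cancel_left hx).1 h)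
        have h1 : S x = T (x + b) - T b := by rw [← hS _ hxb, ← hS _ hb, map_add]; abel
        rw [h1]
        refine sub_mem (span_le.2 ?_ (hT1 _ hxb).1) (span_mono (by simp) (hT1 _ hb).1)
        rw [Set.singleton_subset_iff]
        exact (hcol _ _ _).1 (mem_span_pair.2 ⟨1, 1, by simp⟩)
      -- the planes of `f x`, `f b` and of `f x`, `f c` meet in the line of `f x`
      obtain ⟨b, hb⟩ := hdim a a
      rw [Set.pair_eq_singleton] at hb
      obtain ⟨c, hc⟩ := hdim a b
      have hle : span K {x, b} ≤ span K {a, b} := span_le.2 (by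
        rintro _ (rfl | rfl)
        exacts [span_mono (by simp) hx, subset_span (by simp)])
      have hxa : span K {x} ≤ span K {a} := span_le.2 (by simpa using hx)
      obtain ⟨α, β, h1⟩ := mem_span_pair.1 (key b hb)
      obtain ⟨γ, δ, h2⟩ := mem_span_pair.1 (key c fun h => hc (span_mono (by simp) h))
      obtain ⟨-, -, h3⟩ := eq_zero_of_smul_add_smul_add_smul_eq_zero
        (x := f x) (y := f b) (z := f c) (α := α - γ) (β := β) (γ := -δ)
        (fun h => hx0 ((h0 x).1 h)) (fun h => hb (hxa ((hcol1 _ _).2 h)))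
        (fun h => hc (hle ((hcol _ _ _).2 h))) (by
          rw [← sub_eq_zero] at h2
          have : α • f x + β • f b - (γ • f x + δ • f c) = 0 := by
            rw [h1, sub_eq_zero.1 h2, sub_self]
          rw [← this, sub_smul, neg_smul]
          abel)
      rw [neg_eq_zero] at h3
      exact mem_span_singleton.2 ⟨γ, by simpa [h3] using h2⟩
    · rw [hS x hx]
      exact (hT1 x hx).1
  have hinj : ∀ x, S x = 0 → x = 0 := by
    intro x hx
    by_contra hx0
    -- then `S (x + z) = S z` although `x + z` and `z` span distinct lines
    obtain ⟨z, hz⟩ := hdim a x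
    have hza : z ∉ span K {a} := fun h => hz (span_mono (by simp) h)
    have hzx : z ∉ span K {x} := fun h => hz (span_mono (by simp) h)
    have h1 : T z ∈ span L {f (x + z)} := by
      have := hmem (x + z)
      rwa [map_add, hx, zero_add, hS z hza] at this
    obtain ⟨α, hα⟩ := mem_span_singleton.1 h1
    obtain ⟨β, hβ⟩ := mem_span_singleton.1 (hT1 z hza).1
    have hα0 : α ≠ 0 := by
      rintro rfl
      exact (hT1 z hza).2 (by rw [← hα, zero_smul])
    have h2 : x + z ∈ span K {z} := (hcol1 _ _).2 (mem_span_singleton.2 ⟨α⁻¹ * β, by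
      rw [mul_smul, hβ, ← hα, inv_smul_smul₀ hα0]⟩)
    obtain ⟨c, hc⟩ := mem_span_singleton.1
      ((add_mem_cancel_right (mem_span_singleton_self z)).1 h2)
    have := eq_zero_of_smul_add_smul_eq_zero hx0 hzx (α := 1) (β := -c) (by
      rw [neg_smul, hc, one_smul, add_neg_cancel])
    exact one_ne_zero this.1
  have hspan : ∀ x, span L {S x} = span L {f x} := by
    intro x
    by_cases hx : S x = 0
    · rw [hx, (h0 x).2 (hinj x hx)]
    · obtain ⟨c, hc⟩ := mem_span_singleton.1 (hmem x)
      have hc0 : c ≠ 0 := by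
        rintro rfl
        exact hx (by rw [← hc, zero_smul])
      rw [← hc, span_singleton_smul_eq (IsUnit.mk0 c hc0)]
  have hspan2 : ∀ x y, span L {S x, S y} = span L {f x, f y} := fun x y => by
    rw [span_insert, span_insert, hspan, hspan]
  obtain ⟨hbij, σ, hσ⟩ := exists_semilinear_of_mem_span_pair_iff S hinj
    (fun x u v => by
      rw [hcol, hspan2, ← span_singleton_le_iff_mem, ← hspan, span_singleton_le_iff_mem])
    (fun w => by simpa only [hspan] using hsurj w) hdim
  exact ⟨AddEquiv.ofBijective S hbij, σ, hσ, hspan⟩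

end FundamentalTheorem

/-! ### Weak continuity and operators of rank one -/

section Form

variable {K E F : Type*} [DivisionRing K] [AddCommGroup E] [Module K E]
  [AddCommGroup F] [Module Kᵐᵒᵖ F] {B : E →ₗ[K] F →ₗ[Kᵐᵒᵖ] K}

namespace LinWeak

theorem exists_form_ne_zero (hB : IsDualPair B) {x : LinWeak B} (hx : x ≠ 0) :
    ∃ y, form B x y ≠ 0 := by
  by_contra! h
  exact hx (hB.left x h)

theorem exists_form_ne_zero_left (hB : IsDualPair B) {y : F} (hy : y ≠ 0) :
    ∃ x, form B x y ≠ 0 := by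
  by_contra! h
  exact hy (hB.right y h)

theorem form_smul_right (x : LinWeak B) (y : F) (c : K) :
    form B x (MulOpposite.op c • y) = form B x y * c := by
  rw [map_smul]; rfl

theorem form_smul_left (c : K) (x : LinWeak B) (y : F) :
    form B (c • x) y = c * form B x y := by
  rw [map_smul]; rfl

/-- If the functional of `x` on `N` vanishes where that of `a` does, it is a multiple of it. -/
theorem exists_smul_form_eq (N : Submodule Kᵐᵒᵖ F) (a x : LinWeak B)
    (h : ∀ y ∈ N, form B a y = 0 → form B x y = 0) :
    ∃ c : K, ∀ y ∈ N, form B (x - c • a) y = 0 := by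
  by_cases ha : ∀ y ∈ N, form B a y = 0
  · exact ⟨0, fun y hy => by simpa using h y hy (ha y hy)⟩
  push Not at ha
  obtain ⟨y₀, hy₀, hne⟩ := ha
  refine ⟨form B x y₀ * (form B a y₀)⁻¹, fun y hy => ?_⟩
  have key := h (y - MulOpposite.op ((form B a y₀)⁻¹ * form B a y) • y₀)
    (sub_mem hy (smul_mem _ _ hy₀)) (by
      rw [map_sub, form_smul_right, mul_inv_cancel_left₀ hne, sub_self])
  rw [map_sub, form_smul_right] at key
  rw [map_sub, LinearMap.sub_apply, form_smul_left, mul_assoc, key]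

/-- Planes are weakly closed: a vector outside a plane is separated from it by an element of `F`. -/
theorem exists_form_eq_zero_ne_zero (hB : IsDualPair B) {a b x : LinWeak B}
    (hx : x ∉ span K {a, b}) : ∃ y, form B a y = 0 ∧ form B b y = 0 ∧ form B x y ≠ 0 := by
  by_contra! h
  obtain ⟨c, hc⟩ := exists_smul_form_eq (LinearMap.ker (form B b)) a x
    fun y hy hay => h y hay hy
  obtain ⟨d, hd⟩ := exists_smul_form_eq ⊤ b (x - c • a) fun y _ hby => hc y hby
  have h0 : x - c • a - d • b = 0 := hB.left _ fun y => hd y trivial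
  exact hx (mem_span_pair.2 ⟨c, d, by rw [sub_sub, sub_eq_zero] at h0; exact h0.symm⟩)

theorem exists_form_ne_zero_and (hB : IsDualPair B) {x x' : LinWeak B} (hx : x ≠ 0)
    (hx' : x' ≠ 0) : ∃ y, form B x y ≠ 0 ∧ form B x' y ≠ 0 := by
  obtain ⟨y, hy⟩ := exists_form_ne_zero hB hx
  obtain ⟨y', hy'⟩ := exists_form_ne_zero hB hx'
  by_cases h1 : form B x' y = 0
  · by_cases h2 : form B x y' = 0
    · exact ⟨y + y', by simpa [h2] using hy, by simpa [h1] using hy'⟩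
    · exact ⟨y', h2, hy'⟩
  · exact ⟨y, hy, h1⟩

theorem setOf_form_eq_zero_mem_nhds (y : F) :
    {x : LinWeak B | form B x y = 0} ∈ nhds (0 : LinWeak B) :=
  (mem_nhds_iff' B).2 ⟨span Kᵐᵒᵖ {y}, inferInstance, fun z hz => by
    rw [zero_add]; exact hz y (mem_span_singleton_self y)⟩

/-- An additive map is weakly continuous once the preimages of the hyperplanes `y^⊥`, which form a
subbasis of neighbourhoods of `0`, are neighbourhoods of `0`. Scalars play no part, so this applies
to semilinear maps. -/
theorem continuous_of_forall_form (S : LinWeak B →+ LinWeak B)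
    (h : ∀ y, {x | form B (S x) y = 0} ∈ nhds (0 : LinWeak B)) : Continuous S := by
  refine continuous_of_continuousAt_zero S ?_
  intro U hU
  rw [map_zero] at hU
  obtain ⟨G, hG, hGU⟩ := (mem_nhds_iff' B).1 hU
  obtain ⟨s, rfl⟩ := (fg_iff_finiteDimensional G).2 hG
  have hs : (⋂ y ∈ s, {x | form B (S x) y = 0}) ∈ nhds (0 : LinWeak B) :=
    (Filter.biInter_finset_mem s).2 fun y _ => h y
  refine Filter.mem_map.2 <| Filter.mem_of_superset hs fun x hx => ?_
  have hle : span Kᵐᵒᵖ (s : Set F) ≤ LinearMap.ker (form B (S x)) :=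
    span_le.2 fun y hy => Set.mem_iInter₂.1 hx y hy
  have := hGU (S x) fun y hy => hle hy
  rwa [zero_add] at this

/-- The operator `z ↦ ⟨z, y⟩ x` of rank at most one. -/
def rankOne (x : LinWeak B) (y : F) : ContEnd B where
  toFun z := form B z y • x
  map_add' z z' := by rw [map_add, LinearMap.add_apply, add_smul]
  map_smul' c z := by rw [form_smul_left, mul_smul]; rfl
  cont := continuous_of_forall_form
    (AddMonoidHom.mk' (fun z => form B z y • x) fun z z' => by
      rw [map_add, LinearMap.add_apply, add_smul])
    fun y' => Filter.mem_of_superset (setOf_form_eq_zero_mem_nhds y) fun z hz => by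
      change form B (form B z y • x) y' = 0
      rw [show form B z y = 0 from hz, zero_smul, map_zero, LinearMap.zero_apply]

end LinWeak

/-! ### Images, kernels and atoms of the poset of projections -/

namespace ContProj

open LinWeak

/-- The projection is `z ↦ ⟨T z, y⟩ ⟨T x, y⟩⁻¹ x`. -/
theorem exists_im_eq_span (T : ContEnd B) {x : LinWeak B} {y : F} (h : form B (T x) y ≠ 0) :
    ∃ q : ContProj B, q.im = span K {x} ∧ ∀ z, q.toEnd z = 0 ↔ form B (T z) y = 0 := by
  have hx : x ≠ 0 := by
    rintro rfl
    simp at h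
  have happ : ∀ z, (rankOne ((form B (T x) y)⁻¹ • x) y * T) z
      = (form B (T z) y * (form B (T x) y)⁻¹) • x := fun z => by
    rw [mul_smul]; rfl
  refine ⟨⟨rankOne ((form B (T x) y)⁻¹ • x) y * T, ?_⟩, ?_, fun z => ?_⟩
  · ext z
    rw [mul_apply_eq_comp, happ z, map_smul, happ x, mul_inv_cancel₀ h, one_smul]
  · apply le_antisymm
    · rintro _ ⟨z, rfl⟩
      exact mem_span_singleton.2 ⟨_, (happ z).symm⟩
    · rw [span_singleton_le_iff_mem]
      exact ⟨x, (happ x).trans (by rw [mul_inv_cancel₀ h, one_smul])⟩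
  · change (rankOne ((form B (T x) y)⁻¹ • x) y * T) z = 0 ↔ _
    rw [happ, smul_eq_zero, or_iff_left hx, mul_eq_zero, or_iff_left (inv_ne_zero h)]

theorem mem_ker {p : ContProj B} {x : LinWeak B} : x ∈ p.ker ↔ p.toEnd x = 0 := Iff.rfl

theorem mem_im {p : ContProj B} {x : LinWeak B} : x ∈ p.im ↔ p.toEnd x = x :=
  ⟨p.apply_of_mem_im, fun h => ⟨x, h⟩⟩

theorem apply_mem_im (p : ContProj B) (x : LinWeak B) : p.toEnd x ∈ p.im := ⟨x, rfl⟩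

theorem sub_apply_mem_ker (p : ContProj B) (x : LinWeak B) : x - p.toEnd x ∈ p.ker := by
  rw [mem_ker, map_sub, p.apply_apply, sub_self]

theorem compl_apply (p : ContProj B) (x : LinWeak B) : pᶜ.toEnd x = x - p.toEnd x := rfl

theorem im_compl (p : ContProj B) : pᶜ.im = p.ker := by
  ext x
  rw [mem_ker, mem_im, compl_apply, sub_eq_self]

theorem le_iff {p q : ContProj B} : p ≤ q ↔ p.im ≤ q.im ∧ q.ker ≤ p.ker := Iff.rfl

theorem im_le_im_iff {p q : ContProj B} : p.im ≤ q.im ↔ q.toEnd * p.toEnd = p.toEnd := by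
  constructor
  · intro h
    ext x
    exact q.apply_of_mem_im (h ⟨x, rfl⟩)
  · rintro h _ ⟨x, rfl⟩
    exact ⟨p.toEnd x, congrArg (fun T : ContEnd B => T x) h⟩

theorem ker_le_ker_iff {p q : ContProj B} : q.ker ≤ p.ker ↔ p.toEnd * q.toEnd = p.toEnd := by
  constructor
  · intro h
    ext x
    have := h (q.sub_apply_mem_ker x)
    rw [mem_ker, map_sub, sub_eq_zero] at this
    exact this.symm
  · intro h x hx
    rw [mem_ker] at hx ⊢
    rw [← h, mul_apply_eq_comp, hx, map_zero]

theorem eq_of_im_eq_of_ker_eq {p q : ContProj B} (h : p.im = q.im) (h' : p.ker = q.ker) : p = q :=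
  le_antisymm (le_iff.2 ⟨h.le, h'.ge⟩) (le_iff.2 ⟨h.ge, h'.le⟩)

instance : OrderBot (ContProj B) where
  bot := ⟨0, zero_mul 0⟩
  bot_le _ := le_iff.2 ⟨im_le_im_iff.2 (mul_zero _), ker_le_ker_iff.2 (zero_mul _)⟩

theorem bot_toEnd : (⊥ : ContProj B).toEnd = 0 := rfl

theorem im_eq_bot_iff {p : ContProj B} : p.im = ⊥ ↔ p = ⊥ := by
  constructor
  · intro h
    ext x
    exact (Submodule.mem_bot K).1 (h.le (p.apply_mem_im x))
  · rintro rfl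
    exact LinearMap.range_zero

theorem eq_of_im_eq_of_ker_le {p q : ContProj B} (h : p.im = q.im) (h' : q.ker ≤ p.ker) :
    p = q := by
  refine le_antisymm (le_iff.2 ⟨h.le, h'⟩) (le_iff.2 ⟨h.ge, fun z hz => ?_⟩)
  have h1 := h' (q.sub_apply_mem_ker z)
  rw [mem_ker, map_sub, mem_ker.1 hz, zero_sub, neg_eq_zero,
    p.apply_of_mem_im (h.ge (q.apply_mem_im z))] at h1
  exact h1

theorem isAtom_of_im_eq_span {p : ContProj B} {x : LinWeak B} (hx : x ≠ 0)
    (h : p.im = span K {x}) : IsAtom p := by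
  refine ⟨fun hp => hx ?_, fun q hq => ?_⟩
  · rw [im_eq_bot_iff.2 hp] at h
    exact span_singleton_eq_bot.1 h.symm
  · have hle : q.im ≤ span K {x} := h ▸ hq.le.1
    rcases (nonzero_span_atom x hx).le_iff.1 hle with h1 | h1
    · exact im_eq_bot_iff.1 h1
    · exact absurd (eq_of_im_eq_of_ker_le (h1.trans h.symm) hq.le.2) hq.ne

theorem exists_le_im_eq_span (hB : IsDualPair B) {p : ContProj B} {x : LinWeak B} (hx : x ≠ 0)
    (hxp : x ∈ p.im) : ∃ q ≤ p, q.im = span K {x} := by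
  obtain ⟨y, hy⟩ := exists_form_ne_zero hB hx
  obtain ⟨q, hq, hq'⟩ := exists_im_eq_span p.toEnd (x := x) (y := y) (by
    rwa [p.apply_of_mem_im hxp])
  refine ⟨q, le_iff.2 ⟨?_, fun z hz => ?_⟩, hq⟩
  · rwa [hq, span_singleton_le_iff_mem]
  · rw [mem_ker, hq', mem_ker.1 hz, map_zero, LinearMap.zero_apply]

theorem exists_im_eq_span_of_isAtom (hB : IsDualPair B) {p : ContProj B} (hp : IsAtom p) :
    ∃ x ≠ 0, p.im = span K {x} := by
  obtain ⟨x, hx, hx0⟩ := p.im.exists_mem_ne_zero_of_ne_bot (mt im_eq_bot_iff.1 hp.1)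
  obtain ⟨q, hqp, hq⟩ := exists_le_im_eq_span hB hx0 hx
  rcases hp.le_iff.1 hqp with rfl | rfl
  · exact absurd rfl (isAtom_of_im_eq_span hx0 hq).1
  · exact ⟨x, hx0, hq⟩

/-- The kernel of an atom is a hyperplane, hence maximal among proper kernels. -/
theorem ker_eq_of_ker_le_of_isAtom {p q : ContProj B} (hB : IsDualPair B) (hp : IsAtom p)
    (h : p.ker ≤ q.ker) (hq : q ≠ ⊥) : p.ker = q.ker := by
  obtain ⟨x, hx, hpx⟩ := exists_im_eq_span_of_isAtom hB hp
  refine le_antisymm h fun z hz => ?_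
  have h1 := h (p.sub_apply_mem_ker z)
  rw [mem_ker, map_sub, mem_ker.1 hz, zero_sub, neg_eq_zero] at h1
  by_contra hz0
  have hz1 : p.toEnd z ≠ 0 := hz0
  refine hq (im_eq_bot_iff.1 ?_)
  obtain ⟨c, hc⟩ := mem_span_singleton.1 (hpx.le (p.apply_mem_im z))
  have hc0 : c ≠ 0 := by rintro rfl; exact hz1 (by rw [← hc, zero_smul])
  have hqx : q.toEnd x = 0 := by
    rw [← hc, map_smul] at h1
    exact (smul_eq_zero.1 h1).resolve_left hc0
  rw [eq_bot_iff]
  rintro _ ⟨w, rfl⟩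
  have h2 := h (p.sub_apply_mem_ker w)
  obtain ⟨d, hd⟩ := mem_span_singleton.1 (hpx.le (p.apply_mem_im w))
  rw [mem_ker, map_sub, ← hd, map_smul, hqx, smul_zero, sub_zero] at h2
  exact h2

/-- The line of the image of an atom can be moved freely, the kernel being kept. -/
theorem exists_im_eq_span_ker_eq (hB : IsDualPair B) {p : ContProj B} (hp : IsAtom p)
    {x : LinWeak B} (hx : x ∉ p.ker) : ∃ q : ContProj B, q.im = span K {x} ∧ q.ker = p.ker := by
  have hx0 : x ≠ 0 := by rintro rfl; exact hx (zero_mem _)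
  obtain ⟨y, hy⟩ := exists_form_ne_zero hB (x := p.toEnd x) hx
  obtain ⟨q, hq, hq'⟩ := exists_im_eq_span p.toEnd hy
  refine ⟨q, hq, (ker_eq_of_ker_le_of_isAtom hB hp (fun z hz => ?_)
    (isAtom_of_im_eq_span hx0 hq).1).symm⟩
  rw [mem_ker, hq', mem_ker.1 hz, map_zero, LinearMap.zero_apply]

end ContProj

end Form

/-! ### Automorphisms induced by the ring -/

section OrthoposetAutomorphisms

variable {K E F : Type*} [DivisionRing K] [AddCommGroup E] [Module K E]
  [AddCommGroup F] [Module Kᵐᵒᵖ F] {B : E →ₗ[K] F →ₗ[Kᵐᵒᵖ] K}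

namespace ContProj

open LinWeak

theorem le_iff_mul_eq {p q : ContProj B} :
    p ≤ q ↔ q.toEnd * p.toEnd = p.toEnd ∧ p.toEnd * q.toEnd = p.toEnd := by
  rw [le_iff, im_le_im_iff, ker_le_ker_iff]

/-- The action of a ring automorphism of `𝓑(E)` on the idempotents. -/
def congrRingEquiv (Φ : ContEnd B ≃+* ContEnd B) : ContProj B ≃o ContProj B where
  toFun p := ⟨Φ p.toEnd, by rw [← map_mul, p.idem]⟩
  invFun p := ⟨Φ.symm p.toEnd, by rw [← map_mul, p.idem]⟩
  left_inv p := ContProj.ext (Φ.symm_apply_apply _)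
  right_inv p := ContProj.ext (Φ.apply_symm_apply _)
  map_rel_iff' {p q} := by
    simp only [le_iff_mul_eq, Equiv.coe_fn_mk, ← map_mul, EmbeddingLike.apply_eq_iff_eq]

/-- The action of an anti-automorphism of `𝓑(E)` on the idempotents. -/
def congrRingAntiEquiv (Φ : ContEnd B ≃+* (ContEnd B)ᵐᵒᵖ) : ContProj B ≃o ContProj B where
  toFun p := ⟨(Φ p.toEnd).unop, by rw [← MulOpposite.unop_mul, ← map_mul, p.idem]⟩
  invFun p := ⟨Φ.symm (.op p.toEnd), by rw [← map_mul, ← MulOpposite.op_mul, p.idem]⟩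
  left_inv p := ContProj.ext (Φ.symm_apply_apply _)
  right_inv p := ContProj.ext (congrArg MulOpposite.unop (Φ.apply_symm_apply _))
  map_rel_iff' {p q} := by
    simp only [le_iff_mul_eq, Equiv.coe_fn_mk, ← MulOpposite.unop_mul, ← map_mul,
      MulOpposite.unop_inj, EmbeddingLike.apply_eq_iff_eq]
    exact and_comm

theorem isOrthoAut_congrRingEquiv (Φ : ContEnd B ≃+* ContEnd B) :
    IsOrthoAut (congrRingEquiv Φ) := fun p =>
  ContProj.ext (show Φ (1 - p.toEnd) = 1 - Φ p.toEnd by rw [map_sub, map_one])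

theorem isOrthoAut_congrRingAntiEquiv (Φ : ContEnd B ≃+* (ContEnd B)ᵐᵒᵖ) :
    IsOrthoAut (congrRingAntiEquiv Φ) := fun p =>
  ContProj.ext (show (Φ (1 - p.toEnd)).unop = 1 - (Φ p.toEnd).unop by
    rw [map_sub, map_one]; rfl)

theorem isEven_congrRingEquiv (Φ : ContEnd B ≃+* ContEnd B) : IsEven (congrRingEquiv Φ) := by
  have key : ∀ {p q : ContProj B}, p.im ≤ q.im →
      (congrRingEquiv Φ p).im ≤ (congrRingEquiv Φ q).im := fun {p q} h => by
    rw [im_le_im_iff] at h ⊢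
    change Φ q.toEnd * Φ p.toEnd = Φ p.toEnd
    rw [← map_mul, h]
  exact fun p q h => le_antisymm (key h.le) (key h.ge)

theorem isOdd_congrRingAntiEquiv (Φ : ContEnd B ≃+* (ContEnd B)ᵐᵒᵖ) :
    IsOdd (congrRingAntiEquiv Φ) := by
  have key : ∀ {p q : ContProj B}, p.im ≤ q.im →
      (congrRingAntiEquiv Φ q).ker ≤ (congrRingAntiEquiv Φ p).ker := fun {p q} h => by
    rw [im_le_im_iff] at h
    rw [ker_le_ker_iff]
    change (Φ p.toEnd).unop * (Φ q.toEnd).unop = (Φ p.toEnd).unop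
    rw [← MulOpposite.unop_mul, ← map_mul, h]
  exact fun p q h => le_antisymm (key h.ge) (key h.le)

/-! ### The map on points induced by an even automorphism -/

/-- An order automorphism that, on atoms, respects both equality of images and equality of
kernels. -/
def RespectsAtoms (φ : ContProj B ≃o ContProj B) : Prop :=
  ∀ p q : ContProj B, IsAtom p → IsAtom q →
    (p.im = q.im → (φ p).im = (φ q).im) ∧ (p.ker = q.ker → (φ p).ker = (φ q).ker)

theorem IsEven.respectsAtoms {φ : ContProj B ≃o ContProj B} (ho : IsOrthoAut φ) (he : IsEven φ) :
    RespectsAtoms φ := fun p q _ _ =>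
  ⟨he p q, fun h => by
    rw [← im_compl, ← im_compl, ← ho, ← ho]
    exact he _ _ (by rw [im_compl, im_compl, h])⟩

theorem exists_im_eq_span_of_form (x : LinWeak B) {y : F} (h : form B x y ≠ 0) :
    ∃ q : ContProj B, q.im = span K {x} ∧ ∀ z, q.toEnd z = 0 ↔ form B z y = 0 :=
  exists_im_eq_span 1 h

/-- If `φ p` and `φ q` have the same image, choose `r` with the image of `p` and `r'` with the image
of `q` that share a kernel: then `φ r` and `φ r'` agree in image and kernel, so that `r = r'`. The
argument for kernels is dual. -/
theorem RespectsAtoms.symm (hB : IsDualPair B) {φ : ContProj B ≃o ContProj B}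
    (h : RespectsAtoms φ) : RespectsAtoms φ.symm := by
  suffices H : ∀ p q : ContProj B, IsAtom p → IsAtom q →
      ((φ p).im = (φ q).im → p.im = q.im) ∧ ((φ p).ker = (φ q).ker → p.ker = q.ker) by
    intro p q hp hq
    simpa using H (φ.symm p) (φ.symm q) ((φ.symm.isAtom_iff p).2 hp) ((φ.symm.isAtom_iff q).2 hq)
  intro p q hp hq
  obtain ⟨x, hx, hpx⟩ := exists_im_eq_span_of_isAtom hB hp
  obtain ⟨x', hx', hqx⟩ := exists_im_eq_span_of_isAtom hB hq
  constructor
  · intro him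
    obtain ⟨y, hy, hy'⟩ := exists_form_ne_zero_and hB hx hx'
    obtain ⟨r, hr, hrk⟩ := exists_im_eq_span_of_form x hy
    obtain ⟨r', hr', hrk'⟩ := exists_im_eq_span_of_form x' hy'
    have hra := isAtom_of_im_eq_span hx hr
    have hra' := isAtom_of_im_eq_span hx' hr'
    have hker : r.ker = r'.ker := by ext z; rw [mem_ker, mem_ker, hrk, hrk']
    have : r = r' := φ.injective <| eq_of_im_eq_of_ker_eq
      (by rw [(h r p hra hp).1 (hr.trans hpx.symm), him, (h q r' hq hra').1 (hqx.trans hr'.symm)])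
      ((h r r' hra hra').2 hker)
    rw [hpx, hqx, ← hr, ← hr', this]
  · intro hker
    have hxp : p.toEnd x ≠ 0 := by
      rwa [p.apply_of_mem_im (hpx.ge (mem_span_singleton_self x))]
    have hxq : q.toEnd x' ≠ 0 := by
      rwa [q.apply_of_mem_im (hqx.ge (mem_span_singleton_self x'))]
    obtain ⟨w, hw, hw'⟩ : ∃ w, w ∉ p.ker ∧ w ∉ q.ker := by
      by_cases h1 : q.toEnd x = 0
      · by_cases h2 : p.toEnd x' = 0
        · exact ⟨x + x', by simpa [mem_ker, h2] using hxp, by simpa [mem_ker, h1] using hxq⟩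
        · exact ⟨x', h2, hxq⟩
      · exact ⟨x, hxp, h1⟩
    have hw0 : w ≠ 0 := by rintro rfl; exact hw (zero_mem _)
    obtain ⟨r, hr, hrk⟩ := exists_im_eq_span_ker_eq hB hp hw
    obtain ⟨r', hr', hrk'⟩ := exists_im_eq_span_ker_eq hB hq hw'
    have hra := isAtom_of_im_eq_span hw0 hr
    have hra' := isAtom_of_im_eq_span hw0 hr'
    have : r = r' := φ.injective <| eq_of_im_eq_of_ker_eq
      ((h r r' hra hra').1 (hr.trans hr'.symm))
      (by rw [(h r p hra hp).2 hrk, hker, (h q r' hq hra').2 hrk'.symm])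
    rw [← hrk, ← hrk', this]

/-- `f` represents, on vectors, the map that `φ` induces on the points of the projective space of
`E`, a point being the image of an atom. The condition at `x = 0` says that `f 0 = 0`. -/
def IsPointMap (φ : ContProj B ≃o ContProj B) (f : LinWeak B → LinWeak B) : Prop :=
  ∀ (p : ContProj B) (x : LinWeak B), p.im = span K {x} → (φ p).im = span K {f x}

theorem exists_im_eq_span_singleton (hB : IsDualPair B) (x : LinWeak B) :
    ∃ p : ContProj B, p.im = span K {x} := by
  by_cases hx : x = 0
  · exact ⟨⊥, by rw [im_eq_bot_iff.2 rfl, hx, span_zero_singleton]⟩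
  · obtain ⟨y, hy⟩ := exists_form_ne_zero hB hx
    obtain ⟨p, hp, -⟩ := exists_im_eq_span_of_form x hy
    exact ⟨p, hp⟩

theorem RespectsAtoms.exists_isPointMap (hB : IsDualPair B) {φ : ContProj B ≃o ContProj B}
    (h : RespectsAtoms φ) : ∃ f, IsPointMap φ f := by
  have : ∀ x, ∃ u, ∀ p : ContProj B, p.im = span K {x} → (φ p).im = span K {u} := by
    intro x
    by_cases hx : x = 0
    · refine ⟨0, fun p hp => ?_⟩
      rw [hx, span_zero_singleton, im_eq_bot_iff] at hp
      rw [span_zero_singleton, im_eq_bot_iff, hp, φ.map_bot]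
    · obtain ⟨p, hp⟩ := exists_im_eq_span_singleton hB x
      have hpa := isAtom_of_im_eq_span hx hp
      obtain ⟨u, -, hu⟩ := exists_im_eq_span_of_isAtom hB ((φ.isAtom_iff p).2 hpa)
      exact ⟨u, fun q hq => by
        rw [← hu, (h q p (isAtom_of_im_eq_span hx hq) hpa).1 (hq.trans hp.symm)]⟩
  choose f hf using this
  exact ⟨f, fun p x => hf x p⟩

theorem IsPointMap.eq_zero_iff (hB : IsDualPair B) {φ : ContProj B ≃o ContProj B}
    {f : LinWeak B → LinWeak B} (hf : IsPointMap φ f) (x : LinWeak B) : f x = 0 ↔ x = 0 := by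
  obtain ⟨p, hp⟩ := exists_im_eq_span_singleton hB x
  rw [← span_singleton_eq_bot (R := K), ← hf p x hp, im_eq_bot_iff, map_eq_bot_iff,
    ← im_eq_bot_iff, hp, span_singleton_eq_bot]

theorem IsPointMap.span_symm_apply (hB : IsDualPair B) {φ : ContProj B ≃o ContProj B}
    {f g : LinWeak B → LinWeak B} (hf : IsPointMap φ f) (hg : IsPointMap φ.symm g)
    (x : LinWeak B) : span K {g (f x)} = span K {x} := by
  obtain ⟨p, hp⟩ := exists_im_eq_span_singleton hB x
  rw [← hg _ _ (hf p x hp), φ.symm_apply_apply, hp]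

/-- A point outside the kernel of `p` is the image of an atom with the kernel of `p`, and `φ` maps
this atom to an atom with the kernel of `φ p`. -/
theorem IsPointMap.apply_ne_zero (hB : IsDualPair B) {φ : ContProj B ≃o ContProj B}
    {f : LinWeak B → LinWeak B} (h : RespectsAtoms φ) (hf : IsPointMap φ f) {p : ContProj B}
    (hp : IsAtom p) {x : LinWeak B} (hx : p.toEnd x ≠ 0) : (φ p).toEnd (f x) ≠ 0 := by
  have hx0 : x ≠ 0 := by rintro rfl; exact hx (map_zero _)
  obtain ⟨q, hq, hqk⟩ := exists_im_eq_span_ker_eq hB hp (x := x) hx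
  have hqa := isAtom_of_im_eq_span hx0 hq
  intro h0
  have h1 : f x ∈ (φ q).ker := by rw [(h q p hqa hp).2 hqk]; exact h0
  have h2 : f x ∈ (φ q).im := by rw [hf q x hq]; exact mem_span_singleton_self _
  rw [mem_ker, apply_of_mem_im _ h2, hf.eq_zero_iff hB] at h1
  exact hx0 h1

theorem mem_ker_iff_of_span_eq {p : ContProj B} {x x' : LinWeak B}
    (h : span K {x} = span K {x'}) : p.toEnd x = 0 ↔ p.toEnd x' = 0 := by
  rw [← mem_ker, ← span_singleton_le_iff_mem, h, span_singleton_le_iff_mem, mem_ker]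

theorem IsPointMap.apply_eq_zero_iff (hB : IsDualPair B) {φ : ContProj B ≃o ContProj B}
    {f g : LinWeak B → LinWeak B} (h : RespectsAtoms φ) (hf : IsPointMap φ f)
    (hg : IsPointMap φ.symm g) {p : ContProj B} (hp : IsAtom p) {x : LinWeak B} :
    (φ p).toEnd (f x) = 0 ↔ p.toEnd x = 0 := by
  refine ⟨fun h0 => ?_, fun h0 => ?_⟩
  · by_contra hx
    exact hf.apply_ne_zero hB h hp hx h0
  · by_contra hx
    have := hg.apply_ne_zero hB (h.symm hB) ((φ.isAtom_iff p).2 hp) hx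
    rw [φ.symm_apply_apply, Ne, mem_ker_iff_of_span_eq (hf.span_symm_apply hB hg x)] at this
    exact this h0

theorem mem_span_pair_iff_forall_isAtom (hB : IsDualPair B) {x a b : LinWeak B} :
    x ∈ span K {a, b} ↔ ∀ p : ContProj B, IsAtom p → p.toEnd a = 0 → p.toEnd b = 0 →
      p.toEnd x = 0 := by
  constructor
  · intro hx p _ ha hb
    obtain ⟨c, d, rfl⟩ := mem_span_pair.1 hx
    rw [map_add, map_smul, map_smul, ha, hb, smul_zero, smul_zero, add_zero]
  · intro h
    by_contra hx
    obtain ⟨y, ha, hb, hy⟩ := exists_form_eq_zero_ne_zero hB hx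
    have hx0 : x ≠ 0 := by rintro rfl; exact hx (zero_mem _)
    obtain ⟨p, hp, hpk⟩ := exists_im_eq_span_of_form x hy
    exact hy ((hpk x).1 (h p (isAtom_of_im_eq_span hx0 hp) ((hpk a).2 ha) ((hpk b).2 hb)))

theorem IsPointMap.mem_span_pair_iff (hB : IsDualPair B) {φ : ContProj B ≃o ContProj B}
    {f g : LinWeak B → LinWeak B} (h : RespectsAtoms φ) (hf : IsPointMap φ f)
    (hg : IsPointMap φ.symm g) (x a b : LinWeak B) :
    x ∈ span K {a, b} ↔ f x ∈ span K {f a, f b} := by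
  rw [mem_span_pair_iff_forall_isAtom hB, mem_span_pair_iff_forall_isAtom hB,
    φ.surjective.forall (p := fun q => IsAtom q → q.toEnd (f a) = 0 → q.toEnd (f b) = 0 →
      q.toEnd (f x) = 0)]
  refine forall_congr' fun p => ?_
  rw [φ.isAtom_iff]
  refine forall_congr' fun hp => ?_
  rw [hf.apply_eq_zero_iff hB h hg hp, hf.apply_eq_zero_iff hB h hg hp,
    hf.apply_eq_zero_iff hB h hg hp]

/-! ### Extension to the ring -/

theorem ker_mem_nhds_of_isAtom (hB : IsDualPair B) {p : ContProj B} (hp : IsAtom p) :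
    {x | p.toEnd x = 0} ∈ nhds (0 : LinWeak B) := by
  obtain ⟨x, hx, hpx⟩ := exists_im_eq_span_of_isAtom hB hp
  obtain ⟨y, hy⟩ := exists_form_ne_zero hB hx
  have h1 : p.toEnd ⁻¹' {z | form B z y = 0} ∈ nhds (0 : LinWeak B) :=
    p.toEnd.continuous.continuousAt.preimage_mem_nhds (by
      rw [map_zero]; exact setOf_form_eq_zero_mem_nhds y)
  refine Filter.mem_of_superset h1 fun z hz => ?_
  obtain ⟨c, hc⟩ := mem_span_singleton.1 (hpx.le (p.apply_mem_im z))
  have hz' : form B (p.toEnd z) y = 0 := hz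
  rw [← hc, form_smul_left, mul_eq_zero, or_iff_left hy] at hz'
  change p.toEnd z = 0
  rw [← hc, hz', zero_smul]

theorem continuous_of_forall_isAtom (hB : IsDualPair B) (S : LinWeak B →+ LinWeak B)
    (h : ∀ q : ContProj B, IsAtom q → ∃ p : ContProj B, IsAtom p ∧
      ∀ x, p.toEnd x = 0 → q.toEnd (S x) = 0) : Continuous S := by
  refine continuous_of_forall_form S fun y => ?_
  by_cases hy : y = 0
  · simp [hy]
  obtain ⟨w, hw⟩ := exists_form_ne_zero_left hB hy
  have hw0 : w ≠ 0 := by rintro rfl; simp at hw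
  obtain ⟨q, hq, hqk⟩ := exists_im_eq_span_of_form w hw
  obtain ⟨p, hp, hpq⟩ := h q (isAtom_of_im_eq_span hw0 hq)
  exact Filter.mem_of_superset (ker_mem_nhds_of_isAtom hB hp) fun x hx => (hqk _).1 (hpq x hx)

/-- Conjugation by a bicontinuous semilinear bijection `S`, as the automorphism `T ↦ S T S⁻¹`. -/
def conjRingEquiv (S : LinWeak B ≃ₜ+ LinWeak B) (σ : K ≃+* K)
    (h : ∀ (a : K) (x : LinWeak B), S (a • x) = σ a • S x) : ContEnd B ≃+* ContEnd B :=
  have h' : ∀ (a : K) (x : LinWeak B), S.symm (a • x) = σ.symm a • S.symm x := fun a x => by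
    rw [S.symm_apply_eq, h, σ.apply_symm_apply, S.apply_symm_apply]
  { toFun := fun T =>
      { toFun := fun x => S (T (S.symm x))
        map_add' := fun x y => by simp only [map_add]
        map_smul' := fun a x => by
          rw [h', map_smul, h, σ.apply_symm_apply, RingHom.id_apply]
        cont := S.continuous.comp (T.continuous.comp S.symm.continuous) }
    invFun := fun T =>
      { toFun := fun x => S.symm (T (S x))
        map_add' := fun x y => by simp only [map_add]
        map_smul' := fun a x => by
          rw [h, map_smul, h', σ.symm_apply_apply, RingHom.id_apply]
        cont := S.symm.continuous.comp (T.continuous.comp S.continuous) }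
    left_inv := fun T => by ext x; simp
    right_inv := fun T => by ext x; simp
    map_mul' := fun T U => by
      ext x
      change S (T (U (S.symm x))) = S (T (S.symm (S (U (S.symm x)))))
      rw [S.symm_apply_apply]
    map_add' := fun T U => by
      ext x
      exact map_add S _ _ }

theorem IsPointMap.apply_mem_im (hB : IsDualPair B) {φ : ContProj B ≃o ContProj B}
    {f : LinWeak B → LinWeak B} (hf : IsPointMap φ f) {p : ContProj B} {x : LinWeak B}
    (hx : x ∈ p.im) : f x ∈ (φ p).im := by
  by_cases hx0 : x = 0
  · rw [(hf.eq_zero_iff hB x).2 hx0]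
    exact zero_mem _
  · obtain ⟨r, hrp, hr⟩ := exists_le_im_eq_span hB hx0 hx
    exact (le_iff.1 (φ.monotone hrp)).1 ((hf r x hr).ge (mem_span_singleton_self _))

theorem apply_eq_self_of_rank_le_one (hr : Module.rank K (LinWeak B) ≤ 1)
    {φ : ContProj B ≃o ContProj B} (ho : IsOrthoAut φ) (p : ContProj B) : φ p = p := by
  by_cases hp : p = ⊥
  · rw [hp, φ.map_bot]
  · obtain ⟨v, hv⟩ := rank_le_one_iff.1 hr
    obtain ⟨x, hx, hx0⟩ := p.im.exists_mem_ne_zero_of_ne_bot (mt im_eq_bot_iff.1 hp)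
    have hp' : p = ⊥ᶜ := by
      obtain ⟨c, rfl⟩ := hv x
      have hc : c ≠ 0 := by rintro rfl; exact hx0 (zero_smul _ _)
      ext z
      obtain ⟨d, rfl⟩ := hv z
      rw [compl_apply, bot_toEnd, p.apply_of_mem_im]
      · exact (sub_zero _).symm
      · refine smul_mem _ _ ?_
        rw [← inv_smul_smul₀ hc v]
        exact smul_mem _ _ hx
    rw [hp', ho, φ.map_bot]

theorem exists_semilinear_extension (hB : IsDualPair B)
    (hdim : ∀ a b : LinWeak B, ∃ c, c ∉ span K {a, b})
    {φ : ContProj B ≃o ContProj B} (ho : IsOrthoAut φ) (he : IsEven φ) :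
    ∃ (σ : K ≃+* K) (S : LinWeak B ≃ₜ+ LinWeak B),
      (∀ (a : K) (x : LinWeak B), S (a • x) = σ a • S x) ∧
      ∀ (p : ContProj B) (x : LinWeak B), (φ p).toEnd x = S (p.toEnd (S.symm x)) := by
  have h := IsEven.respectsAtoms ho he
  obtain ⟨f, hf⟩ := h.exists_isPointMap hB
  obtain ⟨g, hg⟩ := (h.symm hB).exists_isPointMap hB
  obtain ⟨S, σ, hσ, hS⟩ := exists_semilinearEquiv_span_eq f (hf.eq_zero_iff hB)
    (hf.mem_span_pair_iff hB h hg)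
    (fun w => ⟨g w, by
      rw [hg.span_symm_apply hB (φ := φ.symm) hf w]; exact mem_span_singleton_self w⟩) hdim
  have hSf : IsPointMap φ S := fun p x hp => (hf p x hp).trans (hS x).symm
  have key : ∀ {p : ContProj B}, IsAtom p → ∀ x, (φ p).toEnd (S x) = 0 ↔ p.toEnd x = 0 :=
    fun hp x => hSf.apply_eq_zero_iff hB h hg hp
  let S' : LinWeak B ≃ₜ+ LinWeak B :=
    { S with
      continuous_toFun := continuous_of_forall_isAtom hB S.toAddMonoidHom fun q hq =>
        ⟨φ.symm q, (φ.symm.isAtom_iff q).2 hq, fun x hx => by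
          have := (key ((φ.symm.isAtom_iff q).2 hq) x).2 hx
          rwa [φ.apply_symm_apply] at this⟩
      continuous_invFun := continuous_of_forall_isAtom hB S.symm.toAddMonoidHom fun q hq =>
        ⟨φ q, (φ.isAtom_iff q).2 hq, fun x hx => (key hq _).1 (by
          change (φ q).toEnd (S (S.symm x)) = 0
          rwa [S.apply_symm_apply])⟩ }
  refine ⟨σ, S', hσ, fun p x => ?_⟩
  obtain ⟨z, rfl⟩ := S'.surjective x
  have h1 : S (p.toEnd z) ∈ (φ p).im := hSf.apply_mem_im hB (p.apply_mem_im z)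
  have h2 : S (z - p.toEnd z) ∈ (φ p).ker := by
    rw [← im_compl, ← ho]
    exact hSf.apply_mem_im hB (by rw [im_compl]; exact p.sub_apply_mem_ker z)
  rw [S'.symm_apply_apply]
  change (φ p).toEnd (S z) = S (p.toEnd z)
  rw [mem_ker, map_sub, map_sub, apply_of_mem_im _ h1, sub_eq_zero] at h2
  exact h2

end ContProj

end OrthoposetAutomorphisms

theorem rank_le_one_of_span_pair_eq_top {K V : Type*} [DivisionRing K] [AddCommGroup V]
    [Module K V] {a b : V} (h : span K {a, b} = ⊤) (h2 : Module.rank K V ≠ 2) :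
    Module.rank K V ≤ 1 := by
  classical
  have hle : Module.rank K V ≤ 2 := by
    rw [← rank_top, ← h]
    have h1 := rank_span_finset_le (R := K) ({a, b} : Finset V)
    rw [Finset.coe_pair] at h1
    exact h1.trans (by exact_mod_cast Finset.card_le_two)
  obtain ⟨n, hn⟩ := Cardinal.lt_aleph0.1 (hle.trans_lt (Cardinal.natCast_lt_aleph0 (n := 2)))
  rw [hn] at hle h2 ⊢
  have h3 : n ≤ 2 := by exact_mod_cast hle
  have h4 : n ≠ 2 := by rintro rfl; exact h2 rfl
  exact_mod_cast (by omega : n ≤ 1)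

end

theorem proposition5 {K E F : Type*} [DivisionRing K] [AddCommGroup E] [Module K E]
    [AddCommGroup F] [Module Kᵐᵒᵖ F] (B : E →ₗ[K] F →ₗ[Kᵐᵒᵖ] K) (hB : IsDualPair B) :
    -- automorphisms of the ring restrict to even orthoposet automorphisms
    (∀ Φ : ContEnd B ≃+* ContEnd B, ∃ φ : ContProj B ≃o ContProj B,
      (∀ p : ContProj B, (φ p).toEnd = Φ p.toEnd) ∧
        ContProj.IsOrthoAut φ ∧ ContProj.IsEven φ) ∧
    -- anti-automorphisms of the ring restrict to odd orthoposet automorphisms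
    (∀ Φ : ContEnd B ≃+* (ContEnd B)ᵐᵒᵖ, ∃ φ : ContProj B ≃o ContProj B,
      (∀ p : ContProj B, (φ p).toEnd = MulOpposite.unop (Φ p.toEnd)) ∧
        ContProj.IsOrthoAut φ ∧ ContProj.IsOdd φ) ∧
    -- even orthoposet automorphisms extend to ring automorphisms `T ↦ S T S⁻¹`,
    -- with `S` a bicontinuous semilinear bijection
    (Module.rank K E ≠ 2 →
      ∀ φ : ContProj B ≃o ContProj B, ContProj.IsOrthoAut φ → ContProj.IsEven φ →
        ∃ (Φ : ContEnd B ≃+* ContEnd B) (σ : K ≃+* K) (S : LinWeak B ≃ₜ+ LinWeak B),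
          (∀ (a : K) (x : LinWeak B), S (a • x) = σ a • S x) ∧
          (∀ (T : ContEnd B) (x : LinWeak B), Φ T x = S (T (S.symm x))) ∧
          (∀ p : ContProj B, Φ p.toEnd = (φ p).toEnd)) := by
  refine ⟨fun Φ => ⟨ContProj.congrRingEquiv Φ, fun _ => rfl, ContProj.isOrthoAut_congrRingEquiv Φ,
    ContProj.isEven_congrRingEquiv Φ⟩, fun Φ => ⟨ContProj.congrRingAntiEquiv Φ, fun _ => rfl,
    ContProj.isOrthoAut_congrRingAntiEquiv Φ, ContProj.isOdd_congrRingAntiEquiv Φ⟩,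
    fun hrank φ ho he => ?_⟩
  by_cases hdim : ∀ a b : LinWeak B, ∃ c, c ∉ Submodule.span K {a, b}
  · obtain ⟨σ, S, hσ, hS⟩ := ContProj.exists_semilinear_extension hB hdim ho he
    exact ⟨ContProj.conjRingEquiv S σ hσ, σ, S, hσ, fun _ _ => rfl,
      fun p => ContinuousLinearMap.ext fun x => (hS p x).symm⟩
  · push Not at hdim
    obtain ⟨a, b, hab⟩ := hdim
    have hr : Module.rank K (LinWeak B) ≤ 1 :=
      rank_le_one_of_span_pair_eq_top (Submodule.eq_top_iff'.2 hab) hrank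
    exact ⟨RingEquiv.refl _, RingEquiv.refl _, ContinuousAddEquiv.refl _, fun _ _ => rfl,
      fun _ _ => rfl, fun p => by
        rw [ContProj.apply_eq_self_of_rank_le_one hr ho p]; rfl⟩
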